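/- Let $a,\gamma>0$, $p>\frac23$ and $1-p<\alpha<\frac13$, and consider the quasilinear Benney system $$iu_t+u_{xx}=a|u|^pu+uv,\qquad v_t+f(v)_x=(|u|^2)_x,\qquad f(v)=-\gamma v^3,$$ for $u=u(x,t)\in\mathbb C$, $v=v(x,t)\in\mathbb R$. Then there is $\mu_0>0$, depending on $\alpha$ (and on $a,\gamma,p$), and for every $0<\mu<\mu_0$ there are $w=w(\mu,\alpha)\in\mathbb R$, a speed $c=c(\mu,\alpha)>0$ and real functions $\phi=\phi_{\mu,\alpha}$, $\psi=\psi_{\mu,\alpha}$ on $\mathbb R$, neither identically zero, such that $$u(x,t)=e^{iwt}e^{i\frac c2(x-ct)}\phi(x-ct),\qquad v(x,t)=\psi(x-ct)$$ is a classical solution of the system, and such that $\phi$ and $-\psi$ are non-negative, radially decreasing (that is, even and non-increasing on $[0,\infty)$) and smooth, with all derivatives in $L^2(\mathbb R)$, i.e. $\phi,\psi\in H^\infty(\mathbb R)$. These families can be chosen such that moreover: (i) if $0<\alpha<\frac13$, there is a constant $C>0$, independent of $\mu$, such that for all $0<\mu<\mu_0$ $$\|\phi_{\mu,\alpha}\|_{H^1}^2+\|\psi_{\mu,\alpha}\|_{L^2}^2\le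 C\mu^{\frac14(1-3\alpha)};$$ (ii) $c(\mu,\alpha)\approx\mu^{\frac12(3-\alpha)}$ as $\mu\to0^+$, i.e. there are constants $0<m\le M$ with $m\,\mu^{\frac12(3-\alpha)}\le c(\mu,\alpha)\le M\,\mu^{\frac12(3-\alpha)}$ for all sufficiently small $\mu>0$. In particular $c(\mu,\alpha)\to0^+$ as $\mu\to0^+$, so the speed can be arbitrarily small. -/

import Mathlib

open MeasureTheory Filter Topology Asymptotics
open scoped ContDiff

noncomputable section

namespace Benney

/-- `(u, v)`, with arguments `(x, t)`, is a classical solution on `ℝ × ℝ` of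
`i u_t + u_xx = a |u|^p u + u v`, `v_t + f(v)_x = (|u|^2)_x` with `f(v) = -γ v^3`. -/
structure IsSolution (a γ p : ℝ) (u : ℝ → ℝ → ℂ) (v : ℝ → ℝ → ℝ) : Prop where
  contDiff_u : ContDiff ℝ 2 (fun z : ℝ × ℝ => u z.1 z.2)
  contDiff_v : ContDiff ℝ 1 (fun z : ℝ × ℝ => v z.1 z.2)
  schrodinger : ∀ x t : ℝ,
    Complex.I * deriv (fun s => u x s) t + iteratedDeriv 2 (fun y => u y t) x
      = (a : ℂ) * ((‖u x t‖ ^ p : ℝ) : ℂ) * u x t + u x t * (v x t : ℂ)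
  conservation : ∀ x t : ℝ,
    deriv (fun s => v x s) t + deriv (fun y => -γ * v y t ^ 3) x
      = deriv (fun y => ‖u y t‖ ^ 2) x

/-- The short wave `u(x,t) = e^{iwt} e^{i (c/2) (x - ct)} φ(x - ct)`. -/
def shortWave (w c : ℝ) (φ : ℝ → ℝ) (x t : ℝ) : ℂ :=
  Complex.exp (Complex.I * (w * t)) * Complex.exp (Complex.I * (c / 2 * (x - c * t)))
    * (φ (x - c * t) : ℂ)

/-- The long wave `v(x,t) = ψ(x - ct)`. -/
def longWave (c : ℝ) (ψ : ℝ → ℝ) (x t : ℝ) : ℝ := ψ (x - c * t)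

/-- Radially decreasing (in the non-strict sense) on the line. -/
def RadiallyDecreasing (f : ℝ → ℝ) : Prop :=
  (∀ x, f (-x) = f x) ∧ AntitoneOn f (Set.Ici 0)

/-- `f` is (the smooth representative of) an element of `H^∞(ℝ) = ⋂ₖ H^k(ℝ)`:
it is `C^∞` and all its derivatives are square integrable. -/
def IsHInfty (f : ℝ → ℝ) : Prop :=
  ContDiff ℝ ∞ f ∧ ∀ k : ℕ, MemLp (iteratedDeriv k f) 2 volume

/-- `‖f‖₂²`. -/
def l2NormSq (f : ℝ → ℝ) : ℝ := ∫ x, f x ^ 2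

/-- `‖f‖²_{H¹} = ‖f‖₂² + ‖f'‖₂²`; used for smooth `f` only. -/
def h1NormSq (f : ℝ → ℝ) : ℝ := l2NormSq f + l2NormSq (deriv f)

end Benney

end

/-! For a travelling wave the second equation integrates once to the algebraic relation `-cψ - γψ³ =
φ²`, and the first becomes a second-order ODE for `φ`. With `c = b⁴`, `ψ = -b² N(b·)`, `φ = b³
Φ(b·)` the system turns into `N + γN³ = Φ²`, `Φ'' = (κ + ε Φ^p - N) Φ`, `ε = a b^(3p-2)`. As `p >
2/3`, `ε` is small with `b`, so a solitary wave is needed only for weak self-interaction.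

Dividing the energy integral by `Φ²` gives `q² = slopeSq N` for `q = Φ'/Φ`, with `κ` fixed by
putting the crest at `N = 1`. There `slopeSq` has a simple zero, where the first-order equation for
`N` is not Lipschitz. Writing `N = 1 / cosh s` removes the square root singularity: `s` solves a
scalar equation with even right-hand side between positive constants (`dslope_bounds`,
`exists_odd_solution`). This gives evenness, monotonicity and a decay rate independent of `ε`
(`exists_isProfile`). Smoothness follows from a differential algebra of bounded functions, and the
norm and speed bounds from scaling with `b = μ^((3-α)/8)`. -/

namespace Benney

/-! ### Scalar ODEs and continuous square roots -/

/-- A scalar autonomous equation `s' = h(s)` whose right-hand side is continuous, even and bounded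
between positive constants has an odd global solution, obtained by inverting `∫ 1 / h`. -/
theorem exists_odd_solution {h : ℝ → ℝ} (hc : Continuous h) (heven : ∀ y, h (-y) = h y)
    {m M : ℝ} (hm : 0 < m) (hmh : ∀ y, m ≤ h y) (hhM : ∀ y, h y ≤ M) :
    ∃ s : ℝ → ℝ, (∀ x, HasDerivAt s (h (s x)) x) ∧ (∀ x, s (-x) = -s x) ∧
      (∀ x, 0 ≤ x → m * x ≤ s x) ∧ StrictMono s := by
  have hpos : ∀ y, 0 < h y := fun y => hm.trans_le (hmh y)
  have hM : 0 < M := (hpos 0).trans_le (hhM 0)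
  set G : ℝ → ℝ := fun y => ∫ t in (0 : ℝ)..y, (h t)⁻¹ with hG
  have hGd : ∀ y, HasDerivAt G (h y)⁻¹ y := fun y =>
    ((hc.inv₀ fun t => (hpos t).ne').integral_hasStrictDerivAt 0 y).hasDerivAt
  have hGmono : StrictMono G := strictMono_of_deriv_pos fun y => by
    rw [(hGd y).deriv]; exact inv_pos.2 (hpos y)
  have hG0 : G 0 = 0 := by simp [hG]
  have hGodd : ∀ y, G (-y) = -G y := by
    intro y
    have := intervalIntegral.integral_comp_neg (a := 0) (b := y) (fun t => (h t)⁻¹)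
    simp only [heven, neg_zero] at this
    simp only [hG]
    rw [this, intervalIntegral.integral_symm]
  -- Since `h ≤ M`, `G` grows at least like `y / M` in both directions; hence it is onto and its
  -- inverse is global.
  have hlow : Monotone fun y => G y - M⁻¹ * y :=
    monotone_of_deriv_nonneg
      (fun y => ((hGd y).sub ((hasDerivAt_id y).const_mul _)).differentiableAt) fun y => by
        have := ((hGd y).sub ((hasDerivAt_id y).const_mul M⁻¹)).deriv
        simp only [id] at this
        erw [this]
        have := inv_anti₀ (hpos y) (hhM y)
        linarith
  have hGc : Continuous G := continuous_iff_continuousAt.2 fun y => (hGd y).continuousAt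
  have htop : Tendsto G atTop atTop := by
    refine tendsto_atTop_mono' _ ?_ (tendsto_id.const_mul_atTop (inv_pos.2 hM))
    filter_upwards [eventually_ge_atTop 0] with y hy
    have := hlow hy
    simp only [hG0, mul_zero, sub_zero] at this
    simpa using this
  have hbot : Tendsto G atBot atBot := by
    refine tendsto_atBot_mono' _ ?_ (tendsto_id.const_mul_atBot (inv_pos.2 hM))
    filter_upwards [eventually_le_atBot 0] with y hy
    have := hlow hy
    simp only [hG0, mul_zero, sub_zero] at this
    simpa using this
  have hsurj : Function.Surjective G := hGc.surjective htop hbot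
  set e := hGmono.orderIsoOfSurjective G hsurj with he
  have hes : ∀ x, G (e.symm x) = x := fun x => e.apply_symm_apply x
  have hcont : Continuous e.symm := e.symm.continuous
  have hd : ∀ x, HasDerivAt e.symm (h (e.symm x)) x := fun x => by
    simpa using HasDerivAt.of_local_left_inverse hcont.continuousAt (hGd (e.symm x))
      (inv_pos.2 (hpos _)).ne' (Eventually.of_forall hes)
  refine ⟨e.symm, hd, fun x => hGmono.injective ?_, fun x hx => ?_, e.symm.strictMono⟩
  · rw [hGodd, hes, hes]
  · have hmono : Monotone fun y => e.symm y - m * y :=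
      monotone_of_deriv_nonneg
        (fun y => ((hd y).sub ((hasDerivAt_id y).const_mul _)).differentiableAt) fun y => by
          have := ((hd y).sub ((hasDerivAt_id y).const_mul m)).deriv
          simp only [id] at this
          erw [this]
          linarith [hmh (e.symm y)]
    have h0 : e.symm 0 = 0 := hGmono.injective (by rw [hes, hG0])
    have := hmono hx
    simp only [h0, mul_zero, sub_zero] at this
    linarith

/-- A continuous square root of a function that is differentiable at a point where the root does
not vanish is differentiable there. -/
theorem hasDerivAt_of_sq_eq {q g : ℝ → ℝ} {g' x : ℝ} (hq : ContinuousAt q x)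
    (hsq : ∀ y, q y ^ 2 = g y) (hg : HasDerivAt g g' x) (hx : q x ≠ 0) :
    HasDerivAt q (g' / (2 * q x)) x := by
  have hgx : g x ≠ 0 := by rw [← hsq]; exact pow_ne_zero 2 hx
  have hs := hg.sqrt hgx
  rcases lt_or_gt_of_ne hx with h | h
  · have h1 : q =ᶠ[𝓝 x] fun y => -√(g y) := by
      filter_upwards [hq.eventually (gt_mem_nhds h)] with y hy
      rw [← hsq, Real.sqrt_sq_eq_abs, abs_of_neg hy, neg_neg]
    refine (hs.neg.congr_of_eventuallyEq h1).congr_deriv ?_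
    rw [← hsq, Real.sqrt_sq_eq_abs, abs_of_neg h]
    field_simp
  · have h1 : q =ᶠ[𝓝 x] fun y => √(g y) := by
      filter_upwards [hq.eventually (lt_mem_nhds h)] with y hy
      rw [← hsq, Real.sqrt_sq_eq_abs, abs_of_pos hy]
    refine (hs.congr_of_eventuallyEq h1).congr_deriv ?_
    rw [← hsq, Real.sqrt_sq_eq_abs, abs_of_pos h]

/-! ### Differential algebras and `H^∞` -/

/-- An algebra of differentiable functions that is stable under `deriv` consists of smooth
functions. -/
theorem contDiff_of_mem_differential_subalgebra {A : Subalgebra ℝ (ℝ → ℝ)}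
    (hA : ∀ f ∈ A, Differentiable ℝ f ∧ deriv f ∈ A) {f : ℝ → ℝ} (hf : f ∈ A) :
    ContDiff ℝ ∞ f := by
  refine contDiff_infty.2 fun n => ?_
  induction n generalizing f with
  | zero => exact contDiff_zero.2 (hA f hf).1.continuous
  | succ n ih =>
    push_cast
    exact contDiff_succ_iff_deriv.2 ⟨(hA f hf).1, by simp, ih (hA f hf).2⟩

/-- The algebra generated by bounded functions whose derivatives stay in it is stable under `deriv`
and consists of bounded functions. -/
theorem adjoin_differential_bounded {S : Set (ℝ → ℝ)}
    (hS : ∀ f ∈ S, Differentiable ℝ f ∧ deriv f ∈ Algebra.adjoin ℝ S ∧ ∃ C, ∀ x, |f x| ≤ C)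
    {f : ℝ → ℝ} (hf : f ∈ Algebra.adjoin ℝ S) :
    Differentiable ℝ f ∧ deriv f ∈ Algebra.adjoin ℝ S ∧ ∃ C, ∀ x, |f x| ≤ C := by
  induction hf using Algebra.adjoin_induction with
  | mem f hf => exact hS f hf
  | algebraMap r =>
    have h : (algebraMap ℝ (ℝ → ℝ)) r = fun _ => r := rfl
    rw [h]
    refine ⟨differentiable_const r, ?_, |r|, fun _ => le_rfl⟩
    simp only [deriv_const']
    exact zero_mem _
  | add f g _ _ hf hg =>
    obtain ⟨hf1, hf2, C, hC⟩ := hf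
    obtain ⟨hg1, hg2, D, hD⟩ := hg
    refine ⟨hf1.add hg1, ?_, C + D, fun x => (abs_add_le _ _).trans (add_le_add (hC x) (hD x))⟩
    have : deriv (f + g) = deriv f + deriv g := funext fun x => deriv_add (hf1 x) (hg1 x)
    rw [this]
    exact add_mem hf2 hg2
  | mul f g hfm hgm hf hg =>
    obtain ⟨hf1, hf2, C, hC⟩ := hf
    obtain ⟨hg1, hg2, D, hD⟩ := hg
    refine ⟨hf1.mul hg1, ?_, C * D, fun x => ?_⟩
    · have : deriv (f * g) = deriv f * g + f * deriv g := funext fun x => deriv_mul (hf1 x) (hg1 x)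
      rw [this]
      exact add_mem (mul_mem hf2 hgm) (mul_mem hfm hg2)
    · rw [Pi.mul_apply, abs_mul]
      exact mul_le_mul (hC x) (hD x) (abs_nonneg _) ((abs_nonneg _).trans (hC x))

/-- If the logarithmic derivative of an `L²` function lies in a differential algebra of bounded
functions, then the function is in `H^∞`. -/
theorem isHInfty_of_deriv_eq_mul {S : Set (ℝ → ℝ)}
    (hS : ∀ f ∈ S, Differentiable ℝ f ∧ deriv f ∈ Algebra.adjoin ℝ S ∧ ∃ C, ∀ x, |f x| ≤ C)
    {f b : ℝ → ℝ} (hf : f ∈ Algebra.adjoin ℝ S) (hb : b ∈ Algebra.adjoin ℝ S)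
    (hfb : deriv f = b * f) (hf2 : MemLp f 2 volume) : IsHInfty f := by
  refine ⟨contDiff_of_mem_differential_subalgebra
    (fun g hg => ⟨(adjoin_differential_bounded hS hg).1, (adjoin_differential_bounded hS hg).2.1⟩)
    hf, fun k => ?_⟩
  obtain ⟨d, hd, hk⟩ : ∃ d ∈ Algebra.adjoin ℝ S, iteratedDeriv k f = d * f := by
    induction k with
    | zero => exact ⟨1, one_mem _, by simp⟩
    | succ k ih =>
      obtain ⟨d, hd, hk⟩ := ih
      obtain ⟨hd1, hd2, -⟩ := adjoin_differential_bounded hS hd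
      refine ⟨deriv d + d * b, add_mem hd2 (mul_mem hd hb), ?_⟩
      rw [iteratedDeriv_succ, hk]
      have : deriv (d * f) = deriv d * f + d * deriv f := funext fun x =>
        deriv_mul (hd1 x) ((adjoin_differential_bounded hS hf).1 x)
      rw [this, hfb]
      ring
  obtain ⟨hd1, -, C, hC⟩ := adjoin_differential_bounded hS hd
  rw [hk]
  refine MemLp.of_le_mul (c := C) hf2 (hd1.continuous.aestronglyMeasurable.mul hf2.1)
    (Eventually.of_forall fun x => ?_)
  rw [Pi.mul_apply, norm_mul]
  exact mul_le_mul_of_nonneg_right (hC x) (norm_nonneg _)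

end Benney

/-! ### The potential and its simple zero at the crest -/

noncomputable section

namespace Benney

/-- The potential energy divided by the square of the short wave, up to sign, as a function of the
amplitude `N` of the long wave, in the absence of self-interaction. -/
def coupling (γ N : ℝ) : ℝ := (N / 2 + 3 * γ * N ^ 3 / 4) / (1 + γ * N ^ 2)

/-- The self-interaction `|Φ| ^ p` in terms of the amplitude `N` of the long wave. -/
def selfInteraction (γ p N : ℝ) : ℝ := (N + γ * N ^ 3) ^ (p / 2)

/-- The square of the logarithmic derivative of the short wave as a function of `N`, normalized to
vanish at the crest `N = 1`. -/
def slopeSq (γ p δ N : ℝ) : ℝ :=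
  (coupling γ 1 - coupling γ N) - δ * (selfInteraction γ p 1 - selfInteraction γ p N)

section Potential

variable {γ p : ℝ}

theorem one_add_mul_sq_pos (hγ : 0 < γ) (N : ℝ) : 0 < 1 + γ * N ^ 2 := by positivity

theorem continuous_slopeSq (hγ : 0 < γ) (hp : 0 < p) (δ : ℝ) : Continuous (slopeSq γ p δ) := by
  have h1 : Continuous (coupling γ) := by
    unfold coupling
    exact Continuous.div (by fun_prop) (by fun_prop) fun N => (one_add_mul_sq_pos hγ N).ne'
  have h2 : Continuous (selfInteraction γ p) := by
    unfold selfInteraction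
    exact Continuous.rpow_const (by fun_prop) fun _ => Or.inr (by positivity)
  unfold slopeSq
  fun_prop

/-- Differentiated form of the energy integral: `Φ² * slopeSq`, with `Φ² = N + γN³`, has
`N`-derivative `(κ + δ(p/2+1)Φ^p - N)(1 + 3γN²)`. The first factor below is the right-hand side of
the equation for `q'`. -/
theorem hasDerivAt_slopeSq (hγ : 0 < γ) (p δ : ℝ) {N : ℝ} (hN : 0 < N) :
    HasDerivAt (slopeSq γ p δ)
      ((coupling γ 1 - δ * selfInteraction γ p 1 + δ * (p / 2 + 1) * selfInteraction γ p N - N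
        - slopeSq γ p δ N) * ((1 + 3 * γ * N ^ 2) / (N * (1 + γ * N ^ 2)))) N := by
  have hd := one_add_mul_sq_pos hγ N
  have hb : 0 < N + γ * N ^ 3 := by positivity
  have h1 : HasDerivAt (coupling γ)
      (((1 / 2 + 9 * γ * N ^ 2 / 4) * (1 + γ * N ^ 2) -
        (N / 2 + 3 * γ * N ^ 3 / 4) * (2 * γ * N)) / (1 + γ * N ^ 2) ^ 2) N := by
    have hnum : HasDerivAt (fun N : ℝ => N / 2 + 3 * γ * N ^ 3 / 4) (1 / 2 + 9 * γ * N ^ 2 / 4) N :=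
      (((hasDerivAt_id N).div_const 2).add
        (((hasDerivAt_pow 3 N).const_mul (3 * γ)).div_const 4)).congr_deriv (by push_cast; ring)
    have hden : HasDerivAt (fun N : ℝ => 1 + γ * N ^ 2) (2 * γ * N) N :=
      (((hasDerivAt_pow 2 N).const_mul γ).const_add 1).congr_deriv (by push_cast; ring)
    exact hnum.div hden hd.ne'
  have h2 : HasDerivAt (selfInteraction γ p)
      ((1 + 3 * γ * N ^ 2) * (p / 2) * (N + γ * N ^ 3) ^ (p / 2 - 1)) N := by
    have hbase : HasDerivAt (fun N : ℝ => N + γ * N ^ 3) (1 + 3 * γ * N ^ 2) N :=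
      ((hasDerivAt_id N).add ((hasDerivAt_pow 3 N).const_mul γ)).congr_deriv (by push_cast; ring)
    exact hbase.rpow_const (Or.inl hb.ne')
  have h3 := (h1.const_sub (coupling γ 1)).sub ((h2.const_sub (selfInteraction γ p 1)).const_mul δ)
  refine h3.congr_deriv ?_
  have hpow : (N + γ * N ^ 3) ^ (p / 2 - 1) = selfInteraction γ p N / (N + γ * N ^ 3) := by
    rw [selfInteraction, Real.rpow_sub_one hb.ne']
  rw [hpow, slopeSq]
  have hb' : N + γ * N ^ 3 = N * (1 + γ * N ^ 2) := by ring
  rw [hb']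
  generalize selfInteraction γ p N = P
  generalize selfInteraction γ p 1 = P₁
  generalize coupling γ 1 = L₁
  rw [coupling]
  field_simp
  ring

/-- The difference factors as `(1 - N)(3/4 - X)` with `|X| ≤ 1/4`. -/
theorem coupling_sub_bounds (hγ : 0 < γ) {N : ℝ} (h0 : 0 ≤ N) (h1 : N ≤ 1) :
    (1 - N) / 2 ≤ coupling γ 1 - coupling γ N ∧ coupling γ 1 - coupling γ N ≤ 1 - N := by
  have hd := one_add_mul_sq_pos hγ N
  have key : coupling γ 1 - coupling γ N
      = (1 - N) * (3 / 4 - (1 - γ * N) / (4 * ((1 + γ) * (1 + γ * N ^ 2)))) := by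
    unfold coupling
    field_simp
    ring
  have hden : 0 < 4 * ((1 + γ) * (1 + γ * N ^ 2)) := by positivity
  have hγN : 0 ≤ γ * N := by positivity
  have hx1 : (1 - γ * N) / (4 * ((1 + γ) * (1 + γ * N ^ 2))) ≤ 1 / 4 := by
    rw [div_le_iff₀ hden]
    have : 0 ≤ γ + γ * N ^ 2 + γ * (γ * N ^ 2) := by positivity
    nlinarith
  have hx2 : -(1 / 4) ≤ (1 - γ * N) / (4 * ((1 + γ) * (1 + γ * N ^ 2))) := by
    rw [le_div_iff₀ hden]
    have : 0 ≤ γ * N ^ 2 + γ * (γ * N ^ 2) := by positivity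
    nlinarith
  rw [key]
  have h1N : 0 ≤ 1 - N := by linarith
  constructor <;> nlinarith

/-- For `r ≤ 1` one has `t ≤ t ^ r`; for `r ≥ 1` Bernoulli gives the constant `r`. The constant `1 +
r` covers both. -/
theorem one_sub_rpow_le {r t : ℝ} (hr : 0 < r) (h0 : 0 < t) (h1 : t ≤ 1) :
    1 - t ^ r ≤ (1 + r) * (1 - t) := by
  rcases le_total r 1 with h | h
  · have := Real.rpow_le_rpow_of_exponent_ge h0 h1 h
    rw [Real.rpow_one] at this
    nlinarith
  · have := one_add_mul_self_le_rpow_one_add (s := t - 1) (by linarith) h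
    rw [add_sub_cancel] at this
    nlinarith

theorem selfInteraction_sub_bounds (hγ : 0 < γ) (hp : 0 < p) {N : ℝ} (h0 : 0 < N) (h1 : N ≤ 1) :
    0 ≤ selfInteraction γ p 1 - selfInteraction γ p N ∧
      selfInteraction γ p 1 - selfInteraction γ p N
        ≤ (1 + γ) ^ (p / 2) * (3 * (1 + p / 2)) * (1 - N) := by
  have h3 : N ^ 3 ≤ 1 := pow_le_one₀ h0.le h1
  have hγ3 : γ * N ^ 3 ≤ γ := by nlinarith
  have h13 : 1 - N ^ 3 ≤ 3 * (1 - N) := by nlinarith [mul_nonneg (sub_nonneg.2 h1) h0.le]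
  have hb : 0 < N + γ * N ^ 3 := by positivity
  have hone : selfInteraction γ p 1 = (1 + γ) ^ (p / 2) := by simp [selfInteraction]
  constructor
  · rw [hone, selfInteraction, sub_nonneg]
    exact Real.rpow_le_rpow hb.le (by linarith) (by positivity)
  · set t := (N + γ * N ^ 3) / (1 + γ) with ht
    have ht0 : 0 < t := by positivity
    have ht1 : t ≤ 1 := by rw [ht, div_le_one (by positivity)]; linarith
    have hP : selfInteraction γ p N = (1 + γ) ^ (p / 2) * t ^ (p / 2) := by
      rw [selfInteraction, ← Real.mul_rpow (by positivity) ht0.le, ht,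
        mul_div_cancel₀ _ (by positivity)]
    have htN : 1 - t ≤ 3 * (1 - N) := by
      rw [ht, sub_le_iff_le_add, ← sub_le_iff_le_add', le_div_iff₀ (by positivity)]
      nlinarith
    have h := one_sub_rpow_le (r := p / 2) (by positivity) ht0 ht1
    rw [hone, hP]
    have hc : 0 < (1 + γ) ^ (p / 2) := by positivity
    calc (1 + γ) ^ (p / 2) - (1 + γ) ^ (p / 2) * t ^ (p / 2)
        = (1 + γ) ^ (p / 2) * (1 - t ^ (p / 2)) := by ring
      _ ≤ (1 + γ) ^ (p / 2) * ((1 + p / 2) * (3 * (1 - N))) :=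
          mul_le_mul_of_nonneg_left (h.trans (mul_le_mul_of_nonneg_left htN (by positivity))) hc.le
      _ = _ := by ring

/-- The smallness of `δ` lets self-interaction cost at most `(1 - N) / 4` of the `(1 - N) / 2`
supplied by the coupling. -/
theorem slopeSq_bounds (hγ : 0 < γ) (hp : 0 < p) {δ : ℝ} (hδ : 0 ≤ δ)
    (hδ' : δ * ((1 + γ) ^ (p / 2) * (3 * (1 + p / 2))) ≤ 1 / 4) {N : ℝ} (h0 : 0 < N) (h1 : N ≤ 1) :
    (1 - N) / 4 ≤ slopeSq γ p δ N ∧ slopeSq γ p δ N ≤ 1 - N := by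
  obtain ⟨hL1, hL2⟩ := coupling_sub_bounds hγ h0.le h1
  obtain ⟨hP1, hP2⟩ := selfInteraction_sub_bounds hγ hp h0 h1
  have hP3 := mul_le_mul_of_nonneg_left hP2 hδ
  have hP4 := mul_le_mul_of_nonneg_right hδ' (sub_nonneg.2 h1)
  have hP5 := mul_nonneg hδ hP1
  unfold slopeSq
  constructor <;> nlinarith

theorem slopeSq_one (γ p δ : ℝ) : slopeSq γ p δ 1 = 0 := by simp [slopeSq]

theorem continuous_dslope_slopeSq (hγ : 0 < γ) (hp : 0 < p) (δ : ℝ) :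
    Continuous (dslope (slopeSq γ p δ) 1) := continuous_iff_continuousAt.2 fun N => by
  rcases eq_or_ne N 1 with rfl | h
  · exact continuousAt_dslope_same.2 (hasDerivAt_slopeSq hγ p δ one_pos).differentiableAt
  · exact (continuousAt_dslope_of_ne h).2 (continuous_slopeSq hγ hp δ).continuousAt

theorem one_sub_mul_dslope (γ p δ N : ℝ) :
    (1 - N) * -dslope (slopeSq γ p δ) 1 N = slopeSq γ p δ N := by
  have := sub_smul_dslope (slopeSq γ p δ) 1 N
  rw [slopeSq_one, sub_zero, smul_eq_mul] at this
  rw [← this]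
  ring

/-- Dividing `slopeSq_bounds` by `1 - N` works on the open interval; continuity of `dslope` carries
the bounds to the crest. -/
theorem dslope_bounds (hγ : 0 < γ) (hp : 0 < p) {δ : ℝ} (hδ : 0 ≤ δ)
    (hδ' : δ * ((1 + γ) ^ (p / 2) * (3 * (1 + p / 2))) ≤ 1 / 4) {N : ℝ} (h0 : 0 < N) (h1 : N ≤ 1) :
    1 / 4 ≤ -dslope (slopeSq γ p δ) 1 N ∧ -dslope (slopeSq γ p δ) 1 N ≤ 1 := by
  have key : ∀ y ∈ Set.Ioo (0 : ℝ) 1,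
      1 / 4 ≤ -dslope (slopeSq γ p δ) 1 y ∧ -dslope (slopeSq γ p δ) 1 y ≤ 1 := fun y hy => by
    have h := slopeSq_bounds hγ hp hδ hδ' hy.1 hy.2.le
    rw [← one_sub_mul_dslope] at h
    have hy1 : 0 < 1 - y := sub_pos.2 hy.2
    constructor
    · refine le_of_mul_le_mul_left ?_ hy1
      linarith [h.1]
    · refine le_of_mul_le_mul_left ?_ hy1
      linarith [h.2]
  have hcl : IsClosed {y : ℝ | 1 / 4 ≤ -dslope (slopeSq γ p δ) 1 y ∧
      -dslope (slopeSq γ p δ) 1 y ≤ 1} :=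
    (isClosed_le continuous_const (continuous_dslope_slopeSq hγ hp δ).neg).inter
      (isClosed_le (continuous_dslope_slopeSq hγ hp δ).neg continuous_const)
  have := hcl.closure_subset_iff.2 key
  rw [closure_Ioo zero_ne_one] at this
  exact this ⟨h0.le, h1⟩

end Potential

/-! ### Existence of profiles -/

/-- Positive even profiles: `N` is minus the long wave, `Φ` the short wave and `q` its logarithmic
derivative. -/
structure IsProfile (γ p κ ε : ℝ) (Φ N q : ℝ → ℝ) : Prop where
  Φ_pos : ∀ x, 0 < Φ x
  N_pos : ∀ x, 0 < N x
  N_le : ∀ x, N x ≤ (1 + (x / 9) ^ 2)⁻¹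
  relation : ∀ x, N x + γ * N x ^ 3 = Φ x ^ 2
  abs_q_le : ∀ x, |q x| ≤ 1
  deriv_Φ : ∀ x, HasDerivAt Φ (q x * Φ x) x
  deriv_N : ∀ x, HasDerivAt N
    (2 * (1 + γ * N x ^ 2) * (1 + 3 * γ * N x ^ 2)⁻¹ * q x * N x) x
  deriv_q : ∀ x, HasDerivAt q (κ + ε * Φ x ^ p - N x - q x ^ 2) x
  radial_Φ : RadiallyDecreasing Φ
  radial_N : RadiallyDecreasing N

theorem one_add_sq_le_cosh (y : ℝ) : 1 + y ^ 2 / 2 ≤ Real.cosh y := by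
  have h1 : Real.cosh y = 1 + 2 * Real.sinh (y / 2) ^ 2 := by
    have := Real.cosh_two_mul (y / 2)
    rw [Real.cosh_sq, mul_div_cancel₀ y two_ne_zero] at this
    linarith
  have h2 : (y / 2) ^ 2 ≤ Real.sinh (y / 2) ^ 2 := by
    rw [sq_le_sq]
    rcases le_total 0 (y / 2) with h | h
    · rw [abs_of_nonneg h, abs_of_nonneg (Real.sinh_nonneg_iff.2 h)]
      exact Real.self_le_sinh_iff.2 h
    · rw [abs_of_nonpos h, abs_of_nonpos (Real.sinh_nonpos_iff.2 h)]
      exact neg_le_neg (Real.sinh_le_self_iff.2 h)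
  rw [h1]
  linarith

/-- Solitary waves of unit long-wave amplitude exist for all small self-interactions. -/
theorem exists_isProfile {γ p δ : ℝ} (hγ : 0 < γ) (hp : 0 < p) (hδ : 0 ≤ δ)
    (hδ' : δ * ((1 + γ) ^ (p / 2) * (3 * (1 + p / 2))) ≤ 1 / 4) :
    ∃ κ Φ N q, IsProfile γ p κ (δ * (p / 2 + 1)) Φ N q := by
  set D : ℝ → ℝ := fun N => -dslope (slopeSq γ p δ) 1 N with hD
  set B : ℝ → ℝ := fun N => 2 * (1 + γ * N ^ 2) * (1 + 3 * γ * N ^ 2)⁻¹ with hB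
  set E : ℝ → ℝ := fun y => (Real.cosh y)⁻¹ with hE
  have hEc : Continuous E := Real.continuous_cosh.inv₀ fun y => (Real.cosh_pos y).ne'
  have hE0 : ∀ y, 0 < E y := fun y => inv_pos.2 (Real.cosh_pos y)
  have hE1 : ∀ y, E y ≤ 1 := fun y => inv_le_one_of_one_le₀ (Real.one_le_cosh y)
  have hDc : Continuous D := (continuous_dslope_slopeSq hγ hp δ).neg
  have hDb : ∀ y, 1 / 4 ≤ D (E y) ∧ D (E y) ≤ 1 := fun y =>
    dslope_bounds hγ hp hδ hδ' (hE0 y) (hE1 y)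
  have h3 : ∀ N : ℝ, 0 < 1 + 3 * γ * N ^ 2 := fun N => by positivity
  have hBc : Continuous B := by
    refine Continuous.mul (by fun_prop) (Continuous.inv₀ (by fun_prop) fun N => (h3 N).ne')
  have hBb : ∀ N, 2 / 3 ≤ B N ∧ B N ≤ 2 := fun N => by
    have : 0 ≤ γ * N ^ 2 := by positivity
    simp only [hB, ← div_eq_mul_inv]
    rw [le_div_iff₀ (h3 N), div_le_iff₀ (h3 N)]
    constructor <;> linarith
  -- Chosen so that `tanh² s * R² = slopeSq N`: `tanh² s = (1 - N)(1 + N)` carries the zero at the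
  -- crest and `R² = D / (1 + N)` stays away from zero.
  set R : ℝ → ℝ := fun y => √(D (E y) / (1 + E y)) with hR
  have hRc : Continuous R :=
    ((hDc.comp hEc).div (continuous_const.add hEc) fun y => (add_pos one_pos (hE0 y)).ne').sqrt
  have hRsq : ∀ y, R y ^ 2 = D (E y) / (1 + E y) := fun y =>
    Real.sq_sqrt (div_nonneg (by linarith [(hDb y).1]) (by linarith [hE0 y]))
  have hR0 : ∀ y, 1 / 4 ≤ R y := fun y => by
    refine Real.le_sqrt_of_sq_le ?_
    rw [le_div_iff₀ (by linarith [hE0 y])]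
    linarith [(hDb y).1, hE1 y]
  have hR1 : ∀ y, R y ≤ 1 := fun y => by
    refine Real.sqrt_le_one.2 ?_
    rw [div_le_one (by linarith [hE0 y])]
    linarith [(hDb y).2, hE0 y]
  -- `N' = B q N` with `N = 1 / cosh s` and `q = -tanh s * R` amounts to `s' = B R`. The bounds are
  -- `2/3 * 1/4` and `2 * 1`.
  obtain ⟨s, hs, hsodd, hslow, hsmono⟩ := exists_odd_solution (h := fun y => B (E y) * R y)
    ((hBc.comp hEc).mul hRc) (fun y => by simp [hR, hE, Real.cosh_neg]) (m := 1 / 6) (M := 2)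
    (by norm_num) (fun y => by nlinarith [hBb (E y), hR0 y]) (fun y => by
      nlinarith [hBb (E y), hR0 y, hR1 y])
  have hs0 : s 0 = 0 := by have := hsodd 0; rw [neg_zero] at this; linarith
  set N : ℝ → ℝ := fun x => E (s x) with hN
  set q : ℝ → ℝ := fun x => -(Real.sinh (s x) / Real.cosh (s x)) * R (s x) with hq
  have hsc : Continuous s := continuous_iff_continuousAt.2 fun x => (hs x).continuousAt
  have hN0 : ∀ x, 0 < N x := fun x => hE0 _
  have hN1 : ∀ x, N x ≤ 1 := fun x => hE1 _
  have hb : ∀ x, 0 < N x + γ * N x ^ 3 := fun x => by have := hN0 x; positivity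
  have hNd : ∀ x, HasDerivAt N (B (N x) * q x * N x) x := fun x => by
    have := (hs x).cosh.inv (Real.cosh_pos (s x)).ne'
    refine this.congr_deriv ?_
    simp only [hq, hN, hE]
    have := (Real.cosh_pos (s x)).ne'
    field_simp
  have hqc : Continuous q :=
    ((Real.continuous_sinh.comp hsc).div (Real.continuous_cosh.comp hsc)
      fun x => (Real.cosh_pos _).ne').neg.mul (hRc.comp hsc)
  have hqsq : ∀ x, q x ^ 2 = slopeSq γ p δ (N x) := fun x => by
    rw [← one_sub_mul_dslope]
    change _ = (1 - N x) * D (N x)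
    have h1 : (Real.sinh (s x) / Real.cosh (s x)) ^ 2 = (1 - N x) * (1 + N x) := by
      simp only [hN, hE]
      have := (Real.cosh_pos (s x)).ne'
      rw [div_pow, Real.sinh_sq]
      field_simp
      ring
    have h2 : 1 + N x ≠ 0 := by linarith [hN0 x]
    simp only [hq]
    rw [mul_pow, neg_sq, h1, hRsq]
    change (1 - N x) * (1 + N x) * (D (N x) / (1 + N x)) = _
    field_simp
  have hqne : ∀ x, x ≠ 0 → q x ≠ 0 := fun x hx => by
    have h1 : s x ≠ 0 := fun h => hx (hsmono.injective (h.trans hs0.symm))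
    exact mul_ne_zero (neg_ne_zero.2 (div_ne_zero (Real.sinh_eq_zero.not.2 h1)
      (Real.cosh_pos _).ne')) (by linarith [hR0 (s x)])
  set κ := coupling γ 1 - δ * selfInteraction γ p 1 with hκ
  set Φ : ℝ → ℝ := fun x => √(N x + γ * N x ^ 3) with hΦ
  have hΦ0 : ∀ x, 0 < Φ x := fun x => Real.sqrt_pos.2 (hb x)
  have hΦsq : ∀ x, Φ x ^ 2 = N x + γ * N x ^ 3 := fun x => Real.sq_sqrt (hb x).le
  have hΦp : ∀ x, Φ x ^ p = selfInteraction γ p (N x) := fun x => by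
    simp only [hΦ]
    rw [selfInteraction, Real.sqrt_eq_rpow, ← Real.rpow_mul (hb x).le]
    congr 1
    ring
  have hNc : Continuous N := hEc.comp hsc
  -- Away from the crest, differentiate `q² = slopeSq N` and divide by `2q`. At `x = 0`, where `q`
  -- vanishes, the derivative is recovered as the limit of the nearby ones.
  have hqd : ∀ x, HasDerivAt q (κ + δ * (p / 2 + 1) * Φ x ^ p - N x - q x ^ 2) x := by
    have hne : ∀ x, x ≠ 0 →
        HasDerivAt q (κ + δ * (p / 2 + 1) * Φ x ^ p - N x - q x ^ 2) x := fun x hx => by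
      have h := hasDerivAt_of_sq_eq hqc.continuousAt hqsq
        ((hasDerivAt_slopeSq hγ p δ (hN0 x)).comp x (hNd x)) (hqne x hx)
      refine h.congr_deriv ?_
      have h1 := hqne x hx
      have h2 := (hN0 x).ne'
      have h4 := (h3 (N x)).ne'
      have h5 := (one_add_mul_sq_pos hγ (N x)).ne'
      rw [hΦp, hqsq]
      simp only [hB, hκ]
      field_simp
    intro x
    rcases eq_or_ne x 0 with rfl | hx
    · refine hasDerivAt_of_hasDerivAt_of_ne
        (g := fun x => κ + δ * (p / 2 + 1) * Φ x ^ p - N x - q x ^ 2) hne hqc.continuousAt ?_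
      have hΦc : Continuous Φ := (hNc.add (continuous_const.mul (hNc.pow 3))).sqrt
      exact (((continuous_const.add (continuous_const.mul
        (hΦc.rpow_const fun x => Or.inl (hΦ0 x).ne'))).sub hNc).sub (hqc.pow 2)).continuousAt
    · exact hne x hx
  have hNeven : ∀ x, N (-x) = N x := fun x => by simp [hN, hE, hsodd, Real.cosh_neg]
  have hNanti : AntitoneOn N (Set.Ici 0) := fun x hx y hy hxy => by
    refine inv_anti₀ (Real.cosh_pos _) (Real.cosh_le_cosh.2 ?_)
    have h1 : 0 ≤ s x := hs0 ▸ hsmono.monotone hx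
    have h2 : s x ≤ s y := hsmono.monotone hxy
    rwa [abs_of_nonneg h1, abs_of_nonneg (h1.trans h2)]
  -- From `s x ≥ x / 6`, `cosh (s x) ≥ 1 + x² / 72 ≥ 1 + (x / 9)²`.
  have hNle' : ∀ x, 0 ≤ x → N x ≤ (1 + (x / 9) ^ 2)⁻¹ := fun x hx => by
    refine inv_anti₀ (by positivity) (le_trans ?_ (one_add_sq_le_cosh _))
    have := hslow x hx
    nlinarith [pow_le_pow_left₀ (by positivity) this 2]
  refine ⟨κ, Φ, N, q, hΦ0, hN0, fun x => ?_, fun x => (hΦsq x).symm, fun x => ?_, fun x => ?_, hNd,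
    hqd, ⟨fun x => by simp [hΦ, hNeven], fun x hx y hy hxy => ?_⟩, hNeven, hNanti⟩
  · rcases le_total 0 x with hx | hx
    · exact hNle' x hx
    · have := hNle' (-x) (by linarith)
      rwa [hNeven, neg_div, neg_sq] at this
  · rw [← sq_le_one_iff_abs_le_one, hqsq]
    linarith [(slopeSq_bounds hγ hp hδ hδ' (hN0 x) (hN1 x)).2, hN0 x]
  · have h1 := ((hNd x).add (((hNd x).pow 3).const_mul γ)).sqrt (hb x).ne'
    refine h1.congr_deriv ?_
    change _ / (2 * Φ x) = _
    have h2 := (hΦ0 x).ne'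
    have h4 := (h3 (N x)).ne'
    rw [div_eq_iff (by positivity), show q x * Φ x * (2 * Φ x) = 2 * q x * Φ x ^ 2 by ring, hΦsq]
    simp only [hB]
    field_simp
    push_cast
    ring
  · have h1 := hNanti hx hy hxy
    exact Real.sqrt_le_sqrt (add_le_add h1 (mul_le_mul_of_nonneg_left
      (pow_le_pow_left₀ (hN0 y).le h1 3) hγ.le))

/-! ### Decay, square integrability and regularity of profiles -/

/-- The decay rate common to all profiles. -/
def decay (x : ℝ) : ℝ := (1 + (x / 9) ^ 2)⁻¹

theorem integrable_decay : Integrable decay := by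
  have := integrable_inv_one_add_sq.comp_mul_left' (R := (9 : ℝ)⁻¹) (by norm_num)
  refine this.congr (Eventually.of_forall fun x => ?_)
  simp only [decay, div_eq_inv_mul]

theorem decay_le_one (x : ℝ) : decay x ≤ 1 :=
  inv_le_one_of_one_le₀ (by nlinarith [sq_nonneg (x / 9)])

/-- A continuous function whose square is dominated by a multiple of `decay` lies in `L²`. -/
theorem memLp_of_sq_le_decay {f : ℝ → ℝ} (hf : Continuous f) {C : ℝ}
    (h : ∀ x, f x ^ 2 ≤ C * decay x) : MemLp f 2 volume ∧ l2NormSq f ≤ C * ∫ x, decay x := by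
  have hi : Integrable fun x => f x ^ 2 :=
    (integrable_decay.const_mul C).mono' (hf.pow 2).aestronglyMeasurable
      (Eventually.of_forall fun x => by
        rw [Real.norm_eq_abs, abs_of_nonneg (sq_nonneg _)]
        exact h x)
  refine ⟨(memLp_two_iff_integrable_sq hf.aestronglyMeasurable).2 hi, ?_⟩
  rw [l2NormSq, ← integral_const_mul]
  exact integral_mono hi (integrable_decay.const_mul C) h

theorem l2NormSq_scale (f : ℝ → ℝ) (A : ℝ) {b : ℝ} (hb : 0 < b) :
    l2NormSq (fun x => A * f (b * x)) = A ^ 2 * b⁻¹ * l2NormSq f := by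
  have h := Measure.integral_comp_mul_left (fun x => f x ^ 2) b
  simp only [l2NormSq, mul_pow]
  rw [integral_const_mul, h, abs_of_pos (inv_pos.2 hb), smul_eq_mul, mul_assoc]

theorem IsHInfty.scale {f : ℝ → ℝ} (hf : IsHInfty f) (A : ℝ) {b : ℝ} (hb : 0 < b) :
    IsHInfty fun x => A * f (b * x) := by
  have hd : ContDiff ℝ ∞ fun x => f (b * x) := hf.1.comp (by fun_prop)
  refine ⟨contDiff_const.mul hd, fun k => ?_⟩
  have hk : iteratedDeriv k (fun x => A * f (b * x))
      = fun x => A * (b ^ k * iteratedDeriv k f (b * x)) := by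
    funext x
    rw [iteratedDeriv_const_mul_field,
      iteratedDeriv_comp_const_mul (contDiff_infty.1 hf.1 k)]
  have hc : Continuous (iteratedDeriv k f) :=
    hf.1.continuous_iteratedDeriv k (by exact_mod_cast le_top)
  rw [hk]
  refine MemLp.const_mul (MemLp.const_mul ?_ _) _
  rw [memLp_two_iff_integrable_sq (by fun_prop)]
  exact ((memLp_two_iff_integrable_sq hc.aestronglyMeasurable).1 (hf.2 k)).comp_mul_left' hb.ne'

namespace IsProfile

variable {γ p κ ε : ℝ} {Φ N q : ℝ → ℝ}

theorem N_le_one (h : IsProfile γ p κ ε Φ N q) (x : ℝ) : N x ≤ 1 :=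
  (h.N_le x).trans (decay_le_one x)

theorem continuous_Φ (h : IsProfile γ p κ ε Φ N q) : Continuous Φ :=
  continuous_iff_continuousAt.2 fun x => (h.deriv_Φ x).continuousAt

theorem continuous_N (h : IsProfile γ p κ ε Φ N q) : Continuous N :=
  continuous_iff_continuousAt.2 fun x => (h.deriv_N x).continuousAt

theorem continuous_q (h : IsProfile γ p κ ε Φ N q) : Continuous q :=
  continuous_iff_continuousAt.2 fun x => (h.deriv_q x).continuousAt

theorem N_sq_le (h : IsProfile γ p κ ε Φ N q) (x : ℝ) : N x ^ 2 ≤ 1 * decay x := by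
  have h1 : N x ≤ decay x := h.N_le x
  nlinarith [h.N_pos x, h.N_le_one x]

theorem Φ_sq_le (h : IsProfile γ p κ ε Φ N q) (hγ : 0 < γ) (x : ℝ) :
    Φ x ^ 2 ≤ (1 + γ) * decay x := by
  have h1 : N x ≤ decay x := h.N_le x
  have h2 : N x ^ 3 ≤ N x := by
    have h3 := h.N_pos x
    have h4 := h.N_le_one x
    calc N x ^ 3 ≤ N x ^ 1 := pow_le_pow_of_le_one h3.le h4 (by norm_num)
      _ = N x := pow_one _
  rw [← h.relation x]
  nlinarith

theorem deriv_Φ_sq_le (h : IsProfile γ p κ ε Φ N q) (hγ : 0 < γ) (x : ℝ) :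
    (q x * Φ x) ^ 2 ≤ (1 + γ) * decay x := by
  refine le_trans ?_ (h.Φ_sq_le hγ x)
  rw [mul_pow]
  have := (sq_le_one_iff_abs_le_one (q x)).2 (h.abs_q_le x)
  exact mul_le_of_le_one_left (sq_nonneg _) this

/-- `Φ`, `Φ^p`, `q`, `N` and `(1 + 3γN²)⁻¹` are bounded and generate an algebra closed under
`deriv`: the last makes `N'/N` polynomial in the generators, and `Φ^p` is needed as `p` is real.
Both logarithmic derivatives lie in it. -/
theorem isHInfty (h : IsProfile γ p κ ε Φ N q) (hγ : 0 < γ) (hp : 0 < p) :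
    IsHInfty Φ ∧ IsHInfty N := by
  set P : ℝ → ℝ := fun x => Φ x ^ p with hP
  set r : ℝ → ℝ := fun x => (1 + 3 * γ * N x ^ 2)⁻¹ with hr
  set S : Set (ℝ → ℝ) := {Φ, P, q, N, r} with hS
  have mem : ∀ f ∈ S, f ∈ Algebra.adjoin ℝ S := fun f hf => Algebra.subset_adjoin hf
  have mΦ := mem Φ (by simp [hS])
  have mP := mem P (by simp [hS])
  have mq := mem q (by simp [hS])
  have mN := mem N (by simp [hS])
  have mr := mem r (by simp [hS])
  have h3 : ∀ x, 0 < 1 + 3 * γ * N x ^ 2 := fun x => by positivity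
  set β : ℝ → ℝ := (2 : ℝ) • ((1 + γ • N ^ 2) * r * q) with hβ
  have mβ : β ∈ Algebra.adjoin ℝ S :=
    Subalgebra.smul_mem _ (mul_mem (mul_mem (add_mem (one_mem _)
      (Subalgebra.smul_mem _ (pow_mem mN 2) γ)) mr) mq) 2
  have hβx : ∀ x, β x = 2 * ((1 + γ * N x ^ 2) * r x * q x) := fun _ => rfl
  have dΦ : deriv Φ = q * Φ := funext fun x => (h.deriv_Φ x).deriv
  have dN : deriv N = β * N := funext fun x => by
    rw [(h.deriv_N x).deriv, Pi.mul_apply, hβx]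
    ring
  have hPd : ∀ x, HasDerivAt P (p * P x * q x) x := fun x => by
    refine ((h.deriv_Φ x).rpow_const (p := p) (Or.inl (h.Φ_pos x).ne')).congr_deriv ?_
    rw [Real.rpow_sub_one (h.Φ_pos x).ne']
    have := (h.Φ_pos x).ne'
    simp only [hP]
    field_simp
  have hrd : ∀ x, HasDerivAt r (-(6 * γ) * (N x * (β x * N x) * r x ^ 2)) x := fun x => by
    have h1 : HasDerivAt N (β x * N x) x := (h.deriv_N x).congr_deriv (by rw [hβx]; ring)
    have h2 := (((h1.pow 2).const_mul (3 * γ)).const_add 1).inv (h3 x).ne'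
    refine h2.congr_deriv ?_
    simp only [hr, Pi.pow_apply]
    push_cast
    field_simp
    ring
  have hS' : ∀ f ∈ S, Differentiable ℝ f ∧ deriv f ∈ Algebra.adjoin ℝ S ∧
      ∃ C, ∀ x, |f x| ≤ C := by
    have hΦle : ∀ x, Φ x ≤ 1 + γ := fun x => by
      have := h.Φ_sq_le hγ x
      have := decay_le_one x
      exact abs_le_of_sq_le_sq' (by nlinarith) (by positivity) |>.2
    intro f hf
    simp only [hS, Set.mem_insert_iff, Set.mem_singleton_iff] at hf
    rcases hf with rfl | rfl | rfl | rfl | rfl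
    · refine ⟨fun x => (h.deriv_Φ x).differentiableAt, dΦ ▸ mul_mem mq mΦ, 1 + γ, fun x => ?_⟩
      rw [abs_of_pos (h.Φ_pos x)]
      exact hΦle x
    · refine ⟨fun x => (hPd x).differentiableAt, ?_, (1 + γ) ^ p, fun x => ?_⟩
      · have : deriv P = p • (P * q) := funext fun x => by
          rw [(hPd x).deriv, Pi.smul_apply, Pi.mul_apply, smul_eq_mul, mul_assoc]
        rw [this]
        exact Subalgebra.smul_mem _ (mul_mem mP mq) p
      · rw [abs_of_pos (Real.rpow_pos_of_pos (h.Φ_pos x) p)]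
        exact Real.rpow_le_rpow (h.Φ_pos x).le (hΦle x) hp.le
    · refine ⟨fun x => (h.deriv_q x).differentiableAt, ?_, 1, h.abs_q_le⟩
      have : deriv f = κ • 1 + ε • P - N - f ^ 2 := funext fun x => by
        rw [(h.deriv_q x).deriv]
        simp [hP]
      rw [this]
      exact sub_mem (sub_mem (add_mem (Subalgebra.smul_mem _ (one_mem _) κ)
        (Subalgebra.smul_mem _ mP ε)) mN) (pow_mem mq 2)
    · refine ⟨fun x => (h.deriv_N x).differentiableAt, dN ▸ mul_mem mβ mN, 1, fun x => ?_⟩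
      rw [abs_of_pos (h.N_pos x)]
      exact h.N_le_one x
    · refine ⟨fun x => (hrd x).differentiableAt, ?_, 1, fun x => ?_⟩
      · have : deriv r = (-(6 * γ)) • (N * (β * N) * r ^ 2) := funext fun x => (hrd x).deriv
        rw [this]
        exact Subalgebra.smul_mem _ (mul_mem (mul_mem mN (mul_mem mβ mN)) (pow_mem mr 2)) _
      · rw [abs_of_pos (inv_pos.2 (h3 x))]
        exact inv_le_one_of_one_le₀ (by have : 0 ≤ 3 * γ * N x ^ 2 := by positivity
                                        linarith)
  exact ⟨isHInfty_of_deriv_eq_mul hS' mΦ mq dΦ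
      (memLp_of_sq_le_decay h.continuous_Φ (h.Φ_sq_le hγ)).1,
    isHInfty_of_deriv_eq_mul hS' mN mβ dN (memLp_of_sq_le_decay h.continuous_N h.N_sq_le).1⟩

end IsProfile

/-! ### From profiles to solutions: travelling waves and scaling -/

theorem norm_shortWave (w c : ℝ) (φ : ℝ → ℝ) (x t : ℝ) :
    ‖shortWave w c φ x t‖ = |φ (x - c * t)| := by
  have h1 : Complex.I * (w * t) = ((w * t : ℝ) : ℂ) * Complex.I := by push_cast; ring
  have h2 : Complex.I * (c / 2 * (x - c * t)) = ((c / 2 * (x - c * t) : ℝ) : ℂ) * Complex.I := by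
    push_cast; ring
  rw [shortWave, h1, h2, norm_mul, norm_mul, Complex.norm_exp_ofReal_mul_I,
    Complex.norm_exp_ofReal_mul_I, one_mul, one_mul, Complex.norm_real, Real.norm_eq_abs]

/-- The travelling wave reduction of the Benney system. -/
theorem isSolution_of_profile {a γ p w c : ℝ} {φ φ' ψ : ℝ → ℝ} (hφ : ContDiff ℝ 2 φ)
    (hψ : ContDiff ℝ 1 ψ) (h0 : ∀ x, 0 ≤ φ x) (h1 : ∀ x, HasDerivAt φ (φ' x) x)
    (h2 : ∀ x, HasDerivAt φ' ((w - c ^ 2 / 4) * φ x + a * φ x ^ p * φ x + φ x * ψ x) x)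
    (h3 : ∀ x, -c * ψ x - γ * ψ x ^ 3 = φ x ^ 2) :
    IsSolution a γ p (shortWave w c φ) (longWave c ψ) where
  contDiff_u := by
    have hre : ContDiff ℝ 2 fun z : ℝ × ℝ => ((φ (z.1 - c * z.2) : ℝ) : ℂ) :=
      Complex.ofRealCLM.contDiff.comp (hφ.comp (by fun_prop))
    have hf : ContDiff ℝ 2 fun z : ℝ × ℝ => ((z.1 : ℝ) : ℂ) :=
      Complex.ofRealCLM.contDiff.comp contDiff_fst
    have hs : ContDiff ℝ 2 fun z : ℝ × ℝ => ((z.2 : ℝ) : ℂ) :=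
      Complex.ofRealCLM.contDiff.comp contDiff_snd
    unfold shortWave
    fun_prop
  contDiff_v := hψ.comp (by fun_prop)
  schrodinger x t := by
    set E : ℝ → ℝ → ℂ := fun x t =>
      Complex.exp (Complex.I * (w * t)) * Complex.exp (Complex.I * (c / 2 * (x - c * t))) with hE
    have hx : ∀ y, HasDerivAt (fun y => E y t) (Complex.I * (c / 2) * E y t) y := fun y => by
      have h := (((((hasDerivAt_id y).ofReal_comp.sub_const ((c : ℂ) * t)).const_mul
        ((c : ℂ) / 2)).const_mul Complex.I).cexp).const_mul (Complex.exp (Complex.I * (w * t)))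
      refine h.congr_deriv ?_
      simp only [hE, id, Complex.ofReal_one]
      ring
    have ht : HasDerivAt (fun s => E x s) (Complex.I * (w - c ^ 2 / 2) * E x t) t := by
      have hA := (((hasDerivAt_id t).ofReal_comp.const_mul (w : ℂ)).const_mul Complex.I).cexp
      have hB := ((((((hasDerivAt_id t).ofReal_comp.const_mul (c : ℂ)).const_sub (x : ℂ)).const_mul
        ((c : ℂ) / 2)).const_mul Complex.I).cexp)
      refine (hA.mul hB).congr_deriv ?_
      simp only [hE, id, Complex.ofReal_one]
      ring
    have hφx : ∀ {f f' : ℝ → ℝ}, (∀ y, HasDerivAt f (f' y) y) → ∀ y,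
        HasDerivAt (fun y => ((f (y - c * t) : ℝ) : ℂ)) (f' (y - c * t) : ℝ) y :=
      fun hf y => ((hf (y - c * t)).comp_sub_const y (c * t)).ofReal_comp
    have hφt : HasDerivAt (fun s => ((φ (x - c * s) : ℝ) : ℂ)) ((φ' (x - c * t) * -c : ℝ) : ℂ) t := by
      have h4 : HasDerivAt (fun s => x - c * s) (-c) t := by
        simpa using ((hasDerivAt_id t).const_mul c).const_sub x
      exact ((h1 (x - c * t)).comp t h4).ofReal_comp
    have dt := (ht.mul hφt).deriv
    have dx : deriv (fun y => shortWave w c φ y t) = fun y =>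
        Complex.I * (c / 2) * E y t * ((φ (y - c * t) : ℝ) : ℂ)
          + E y t * ((φ' (y - c * t) : ℝ) : ℂ) := funext fun y => ((hx y).mul (hφx h1 y)).deriv
    have dxx := ((((hx x).const_mul (Complex.I * (c / 2))).mul (hφx h1 x)).add
      ((hx x).mul (hφx h2 x))).deriv
    rw [norm_shortWave, abs_of_nonneg (h0 _), iteratedDeriv_succ, iteratedDeriv_one, dx]
    erw [dt, dxx]
    simp only [shortWave, longWave]
    change _ = (a : ℂ) * _ * (E x t * _) + E x t * _ * _
    push_cast
    -- The phase makes the `φ'` terms `∓ i c φ'` cancel; the coefficients of `φ` combine to `-(w -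
    -- c²/2) - c²/4 = -(w - c²/4)`.
    linear_combination ((w - c ^ 2 / 2) * E x t * (φ (x - c * t) : ℂ)
      + c ^ 2 / 4 * E x t * (φ (x - c * t) : ℂ)) * Complex.I_sq
  conservation x t := by
    have hd : ∀ y, HasDerivAt ψ (deriv ψ y) y := fun y =>
      (hψ.differentiable one_ne_zero y).hasDerivAt
    have hL : HasDerivAt (fun y => -c * ψ y - γ * ψ y ^ 3)
        (-c * deriv ψ (x - c * t) - γ * (3 * ψ (x - c * t) ^ 2 * deriv ψ (x - c * t)))
        (x - c * t) :=
      (((hd _).const_mul (-c)).sub (((hd _).pow 3).const_mul γ)).congr_deriv (by push_cast; ring)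
    -- By the algebraic relation, `|u|²` is the once-integrated left side of the conservation law.
    have hR : (fun y => ‖shortWave w c φ y t‖ ^ 2)
        = fun y => -c * ψ (y - c * t) - γ * ψ (y - c * t) ^ 3 := funext fun y => by
      rw [norm_shortWave, sq_abs, h3]
    have h4 : HasDerivAt (fun s => x - c * s) (-c) t := by
      simpa using ((hasDerivAt_id t).const_mul c).const_sub x
    have ht := ((hd (x - c * t)).comp t h4).deriv
    have hx := ((((hd (x - c * t)).comp_sub_const x (c * t)).pow 3).const_mul (-γ)).deriv
    rw [hR, (hL.comp_sub_const x (c * t)).deriv]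
    simp only [longWave]
    erw [ht, hx]
    push_cast
    ring

/-- The solitary wave obtained from a profile by the scaling with parameter `b`, of speed `b ^ 4`. -/
theorem IsProfile.isSolution {a γ p κ b : ℝ} {Φ N q : ℝ → ℝ} (hγ : 0 < γ) (hp : 0 < p)
    (hb : 0 < b) (h : IsProfile γ p κ (a * b ^ (3 * p - 2)) Φ N q) :
    IsSolution a γ p (shortWave (κ * b ^ 2 + (b ^ 4) ^ 2 / 4) (b ^ 4) fun x => b ^ 3 * Φ (b * x))
      (longWave (b ^ 4) fun x => -b ^ 2 * N (b * x)) := by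
  obtain ⟨hΦ, hN⟩ := h.isHInfty hγ hp
  have hcomp : ∀ {f f' : ℝ → ℝ}, (∀ y, HasDerivAt f (f' y) y) → ∀ y,
      HasDerivAt (fun y => f (b * y)) (b * f' (b * y)) y := fun hf y => by
    have h4 : HasDerivAt (fun y => b * y) b y := by simpa using (hasDerivAt_id y).const_mul b
    exact ((hf (b * y)).comp y h4).congr_deriv (mul_comm _ _)
  refine isSolution_of_profile
    ((hΦ.scale (b ^ 3) hb).1.of_le (WithTop.coe_le_coe.2 le_top))
    ((hN.scale (-b ^ 2) hb).1.of_le (WithTop.coe_le_coe.2 le_top))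
    (fun x => mul_nonneg (by positivity) (h.Φ_pos _).le)
    (fun x => (hcomp h.deriv_Φ x).const_mul (b ^ 3)) (fun x => ?_) (fun x => ?_)
  · refine (((hcomp (fun y => (h.deriv_q y).mul (h.deriv_Φ y)) x).const_mul b).const_mul
      (b ^ 3)).congr_deriv ?_
    have hpow : (b ^ 3 * Φ (b * x)) ^ p = b ^ 2 * b ^ (3 * p - 2) * Φ (b * x) ^ p := by
      rw [Real.mul_rpow (by positivity) (h.Φ_pos _).le, ← Real.rpow_natCast b 3,
        ← Real.rpow_mul hb.le, ← Real.rpow_natCast b 2, ← Real.rpow_add hb]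
      congr 2
      push_cast
      ring
    rw [hpow]
    ring
  · have := h.relation (b * x)
    rw [mul_pow (b ^ 3), ← this]
    ring

theorem RadiallyDecreasing.scale {f : ℝ → ℝ} (hf : RadiallyDecreasing f) {A b : ℝ} (hA : 0 ≤ A)
    (hb : 0 ≤ b) : RadiallyDecreasing fun x => A * f (b * x) :=
  ⟨fun x => by simp only [mul_neg, hf.1], fun x hx y hy hxy =>
    mul_le_mul_of_nonneg_left (hf.2 (mul_nonneg hb hx) (mul_nonneg hb hy)
      (mul_le_mul_of_nonneg_left hxy hb)) hA⟩

/-- The squared norms of `φ`, `φ'`, `ψ` scale as `b⁵`, `b⁷`, `b³`; for `b ≤ 1` the long wave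
dominates. -/
theorem IsProfile.norm_le {γ p κ ε b : ℝ} {Φ N q : ℝ → ℝ} (hγ : 0 < γ) (hb : 0 < b) (hb1 : b ≤ 1)
    (h : IsProfile γ p κ ε Φ N q) :
    h1NormSq (fun x => b ^ 3 * Φ (b * x)) + l2NormSq (fun x => -b ^ 2 * N (b * x))
      ≤ ((2 * (1 + γ) + 1) * ∫ x, decay x) * b ^ 3 := by
  have hd : deriv (fun x => b ^ 3 * Φ (b * x)) = fun x => b ^ 4 * (q * Φ) (b * x) :=
    funext fun x => by
      have h4 : HasDerivAt (fun y => b * y) b x := by simpa using (hasDerivAt_id x).const_mul b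
      refine ((((h.deriv_Φ (b * x)).comp x h4).const_mul (b ^ 3)).congr_deriv ?_).deriv
      simp only [Pi.mul_apply]
      ring
  have e1 := (memLp_of_sq_le_decay h.continuous_Φ (h.Φ_sq_le hγ)).2
  have e2 := (memLp_of_sq_le_decay (h.continuous_q.mul h.continuous_Φ) (h.deriv_Φ_sq_le hγ)).2
  have e3 := (memLp_of_sq_le_decay h.continuous_N h.N_sq_le).2
  set I := ∫ x, decay x
  have n1 : 0 ≤ l2NormSq Φ := integral_nonneg fun x => sq_nonneg _
  have n2 : 0 ≤ l2NormSq (q * Φ) := integral_nonneg fun x => sq_nonneg _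
  rw [h1NormSq, hd, l2NormSq_scale _ _ hb, l2NormSq_scale _ _ hb, l2NormSq_scale _ _ hb]
  have c1 : (b ^ 3) ^ 2 * b⁻¹ = b ^ 3 * b ^ 2 := by field_simp
  have c2 : (b ^ 4) ^ 2 * b⁻¹ = b ^ 3 * b ^ 4 := by field_simp
  have c3 : (-b ^ 2) ^ 2 * b⁻¹ = b ^ 3 := by field_simp
  rw [c1, c2, c3]
  have f1 : b ^ 2 * l2NormSq Φ ≤ (1 + γ) * I :=
    (mul_le_of_le_one_left n1 (pow_le_one₀ hb.le hb1)).trans e1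
  have f2 : b ^ 4 * l2NormSq (q * Φ) ≤ (1 + γ) * I :=
    (mul_le_of_le_one_left n2 (pow_le_one₀ hb.le hb1)).trans e2
  calc b ^ 3 * b ^ 2 * l2NormSq Φ + b ^ 3 * b ^ 4 * l2NormSq (q * Φ) + b ^ 3 * l2NormSq N
      = b ^ 3 * (b ^ 2 * l2NormSq Φ + b ^ 4 * l2NormSq (q * Φ) + l2NormSq N) := by ring
    _ ≤ b ^ 3 * ((1 + γ) * I + (1 + γ) * I + 1 * I) := by gcongr
    _ = _ := by ring

end Benney

end

/-! ### Choice of parameters -/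

theorem mainTheorem2 (a γ p α : ℝ) (ha : 0 < a) (hγ : 0 < γ) (hp : 2 / 3 < p)
    (hα₁ : 1 - p < α) (hα₂ : α < 1 / 3) :
    ∃ μ₀ : ℝ, 0 < μ₀ ∧ ∃ (w c : ℝ → ℝ) (φ ψ : ℝ → ℝ → ℝ),
      (∀ μ : ℝ, 0 < μ → μ < μ₀ →
        0 < c μ ∧
        Benney.IsSolution a γ p (Benney.shortWave (w μ) (c μ) (φ μ))
          (Benney.longWave (c μ) (ψ μ)) ∧
        φ μ ≠ 0 ∧ ψ μ ≠ 0 ∧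
        (∀ x, 0 ≤ φ μ x) ∧ (∀ x, 0 ≤ -ψ μ x) ∧
        Benney.RadiallyDecreasing (φ μ) ∧ Benney.RadiallyDecreasing (fun x => -ψ μ x) ∧
        Benney.IsHInfty (φ μ) ∧ Benney.IsHInfty (ψ μ)) ∧
      (0 < α → ∃ C : ℝ, 0 < C ∧ ∀ μ : ℝ, 0 < μ → μ < μ₀ →
        Benney.h1NormSq (φ μ) + Benney.l2NormSq (ψ μ) ≤ C * μ ^ ((1 - 3 * α) / 4)) ∧
      c =Θ[𝓝[>] 0] (fun μ : ℝ => μ ^ ((3 - α) / 2)) ∧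
      Tendsto c (𝓝[>] 0) (𝓝[>] 0) := by
  have hp0 : 0 < p := by linarith
  -- The scaling parameter is `b = μ ^ θ`, so that `c = b⁴ = μ ^ ((3 - α) / 2)`.
  set θ := (3 - α) / 8 with hθ
  have hθ0 : 0 < θ := by rw [hθ]; linarith
  set K := (1 + γ) ^ (p / 2) * (3 * (1 + p / 2)) with hK
  set δ : ℝ → ℝ := fun μ => a * (μ ^ θ) ^ (3 * p - 2) / (p / 2 + 1) with hδ
  -- Both exponents `θ` and `3p - 2` are positive, so `δ` is continuous and vanishes at `0`; near
  -- `0` the smallness condition of `exists_isProfile` holds.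
  have hlim : ContinuousAt (fun μ => δ μ * K) 0 := by
    have h1 : ContinuousAt (fun μ : ℝ => (μ ^ θ) ^ (3 * p - 2)) 0 :=
      (Real.continuousAt_rpow_const 0 θ (Or.inr hθ0.le)).rpow_const (Or.inr (by linarith))
    exact ((h1.const_mul a).div_const _).mul_const K
  have hδ0 : δ 0 * K < 1 / 4 := by
    simp only [hδ]
    rw [Real.zero_rpow hθ0.ne', Real.zero_rpow (by linarith)]
    norm_num
  obtain ⟨r, hr, hr'⟩ := Metric.eventually_nhds_iff.1 (hlim.eventually (gt_mem_nhds hδ0))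
  have hex : ∀ μ : ℝ, 0 < μ → μ < min r 1 → ∃ κ Φ N q,
      Benney.IsProfile γ p κ (a * (μ ^ θ) ^ (3 * p - 2)) Φ N q := fun μ h0 h1 => by
    have hsmall := hr' (y := μ) (by
      rw [Real.dist_eq, sub_zero, abs_of_pos h0]
      exact h1.trans_le (min_le_left _ _))
    have h := Benney.exists_isProfile (γ := γ) (p := p) (δ := δ μ) hγ hp0 (by positivity) hsmall.le
    rwa [div_mul_cancel₀ _ (by positivity)] at h
  choose! κ Φ N q hprof using hex
  have hc : ∀ μ : ℝ, 0 < μ → (μ ^ θ) ^ 4 = μ ^ ((3 - α) / 2) := fun μ h0 => by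
    rw [← Real.rpow_natCast, ← Real.rpow_mul h0.le]
    congr 1
    rw [hθ]
    push_cast
    ring
  refine ⟨min r 1, lt_min hr one_pos,
    fun μ => κ μ * (μ ^ θ) ^ 2 + ((μ ^ θ) ^ 4) ^ 2 / 4, fun μ => (μ ^ θ) ^ 4,
    fun μ x => (μ ^ θ) ^ 3 * Φ μ (μ ^ θ * x), fun μ x => -(μ ^ θ) ^ 2 * N μ (μ ^ θ * x),
    fun μ h0 h1 => ?_, fun hα => ?_, ?_, ?_⟩
  · have hb : 0 < μ ^ θ := Real.rpow_pos_of_pos h0 θ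
    have h := hprof μ h0 h1
    have hφ : ∀ x, 0 < (μ ^ θ) ^ 3 * Φ μ (μ ^ θ * x) := fun x =>
      mul_pos (by positivity) (h.Φ_pos _)
    have hψ : ∀ x, 0 < -(-(μ ^ θ) ^ 2 * N μ (μ ^ θ * x)) := fun x => by
      have := mul_pos (pow_pos hb 2) (h.N_pos (μ ^ θ * x))
      linarith
    refine ⟨by positivity, h.isSolution hγ hp0 hb, fun he => (hφ 0).ne' (congrFun he 0),
      fun he => (hψ 0).ne' (by rw [neg_eq_zero]; exact congrFun he 0), fun x => (hφ x).le,
      fun x => (hψ x).le, h.radial_Φ.scale (by positivity) hb.le, ?_,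
      (h.isHInfty hγ hp0).1.scale _ hb, (h.isHInfty hγ hp0).2.scale _ hb⟩
    have := h.radial_N.scale (A := (μ ^ θ) ^ 2) (by positivity) hb.le
    simpa only [neg_mul, neg_neg] using this
  · set I := (2 * (1 + γ) + 1) * ∫ x, Benney.decay x with hI
    refine ⟨max I 1, by positivity, fun μ h0 h1 => ?_⟩
    have hμ1 : μ ≤ 1 := (h1.trans_le (min_le_right _ _)).le
    refine ((hprof μ h0 h1).norm_le hγ (Real.rpow_pos_of_pos h0 θ)
      (Real.rpow_le_one h0.le hμ1 hθ0.le)).trans ?_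
    refine mul_le_mul (le_max_left _ _) ?_ (by positivity) (by positivity)
    rw [← Real.rpow_natCast, ← Real.rpow_mul h0.le]
    -- The actual rate is `μ ^ (3(3 - α) / 8)`, and `3(3 - α) / 8 ≥ (1 - 3α) / 4` for `α > 0`.
    refine Real.rpow_le_rpow_of_exponent_ge h0 hμ1 ?_
    rw [hθ]
    push_cast
    linarith
  · refine EventuallyEq.isTheta ?_
    filter_upwards [self_mem_nhdsWithin] with μ hμ using hc μ hμ
  · refine tendsto_nhdsWithin_iff.2 ⟨?_, ?_⟩
    · have h1 : ContinuousAt (fun μ : ℝ => (μ ^ θ) ^ 4) 0 :=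
        (Real.continuousAt_rpow_const 0 θ (Or.inr hθ0.le)).pow 4
      have h2 := h1.tendsto
      simp only [Real.zero_rpow hθ0.ne', ne_eq, OfNat.ofNat_ne_zero, not_false_eq_true,
        zero_pow] at h2
      exact h2.mono_left nhdsWithin_le_nhds
    · filter_upwards [self_mem_nhdsWithin] with μ hμ
      exact pow_pos (Real.rpow_pos_of_pos hμ θ) 4
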